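/- Let $M\ge 1$, let $\Omega\subset\{1,\dots,M\}$ be non-empty with $L=|\Omega|$, and let $y_\Omega\in\mathbb C^{\Omega}$, $y_\Omega\ne 0$. For $v\in\mathbb C^M$ write $v_\Omega$ for its subvector on $\Omega$. For $u\in\mathbb C^M$ let $T(u)$ be the $M\times M$ matrix with entries $T(u)_{jk}=u_{k-j+1}$ for $j\le k$ and $T(u)_{jk}=\overline{u_{j-k+1}}$ for $j>k$, and let $T(u)_\Omega$ be its submatrix on $\Omega\times\Omega$. Let $a(f)=(1,e^{i2\pi f},\dots,e^{i2\pi(M-1)f})^T$, let $\mathcal A(\Omega)=\{a(f)_\Omega\,\phi: f\in[0,1),\ \phi\in\mathbb C,\ |\phi|=1\}$, and let $\|z\|_{\mathcal A(\Omega)}=\inf\{t>0: z\in t\,\mathrm{conv}\,\mathcal A(\Omega)\}$ be the atomic norm on $\mathbb C^\Omega$. For a positive semidefinite $R$, $y^HR^{-1}y$ denotes the least $x\in\mathbb R$ with $\begin{bmatrix}x&y^H\\y&R\end{bmatrix}\ge 0$ ($+\infty$ if there is none). Gridless SPICE (GLS) is the problem $$\min_{u,\sigma}\ \mathrm{tr}(R_\Omega)+\|y_\Omega\|_2^2\,y_\Omega^HR_\Omega^{-1}y_\Omega\quad\text{subject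 to } T(u)\ge 0,\qquad R_\Omega=T(u)_\Omega+\mathrm{diag}(\sigma),$$ where $\sigma\in\mathbb R^\Omega$ ranges over all $\sigma\succeq 0$ (heteroscedastic noise), over all $\sigma=s\mathbf 1$ with $s\ge 0$ (homoscedastic noise), or is fixed to $\sigma=\sigma_0\mathbf 1$ with a given $\sigma_0>0$ (homoscedastic noise with known variance). The corresponding atomic norm denoising (AND) problem $\min_{z_\Omega}\mu\|z_\Omega\|_{\mathcal A(\Omega)}+g(y_\Omega-z_\Omega)$ is, respectively, 1. $\min_{z_\Omega}\ \sqrt L\,\|z_\Omega\|_{\mathcal A(\Omega)}+\|y_\Omega-z_\Omega\|_1$; 2. $\min_{z_\Omega}\ \|z_\Omega\|_{\mathcal A(\Omega)}+\|y_\Omega-z_\Omega\|_2$; 3. $\min_{z_\Omega}\ \frac{\sqrt L}{\|y_\Omega\|_2}\sigma_0\,\|z_\Omega\|_{\mathcal A(\Omega)}+\frac12\|y_\Omega-z_\Omega\|_2^2$. In each of the three cases, the AND problem has the exact semidefinite formulation $$\min_{x\in\mathbb R,\ u\in\mathbb C^M,\ z\in\mathbb C^M}\ \frac{\mu}{2}(x+u_1)+g(y_\Omega-z_\Omega)\quad\text{subject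 to }\begin{bmatrix}x&z^H\\z&T(u)\end{bmatrix}\ge 0$$ (the same minimizers $z_\Omega$ and the same optimal value). Moreover, GLS and this formulation of AND are equivalent: both have optimal solutions, and the set of optimal $u$ of GLS is exactly $\left\{\frac{\|y_\Omega\|_2}{\sqrt L}u^*\right\}$, where $u^*$ ranges over the optimal $u$ of the AND problem. With $c=\|y_\Omega\|_2/\sqrt L>0$, for each such $u^*$ the Vandermonde decompositions $\sum_k p_k\,a(f_k)a(f_k)^H$ of $T(u^*)$ (distinct $f_k\in[0,1)$, $p_k>0$, number of terms equal to the rank) and those of $T(cu^*)$ have the same frequencies $f_k$, and powers $p_k$ that differ by the factor $c$; the same holds for the decompositions of $T(u^*)-\lambda_{\min}(T(u^*))I$ and $T(cu^*)-\lambda_{\min}(T(cu^*))I$. -/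

import Mathlib

open scoped ComplexOrder

noncomputable section

namespace GLS

/-- The complex sinusoid `a(f) = (1, e^{i2πf}, …, e^{i2π(M-1)f})`. -/
def sinusoid (M : ℕ) (f : ℝ) : Fin M → ℂ :=
  fun j => Complex.exp (2 * Real.pi * Complex.I * (j : ℕ) * f)

/-- The atoms `a(f, φ) = a(f) φ` with `f ∈ [0, 1)` and `|φ| = 1`. -/
def atoms (M : ℕ) : Set (Fin M → ℂ) :=
  {a | ∃ f ∈ Set.Ico (0 : ℝ) 1, ∃ φ : ℂ, ‖φ‖ = 1 ∧ a = fun j => sinusoid M f j * φ}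

/-- The subvector `v_Ω` of `v`. -/
def subvec {M : ℕ} (Ω : Finset (Fin M)) (v : Fin M → ℂ) : Ω → ℂ := fun j => v j

/-- The atoms `𝒜(Ω)` for samples on `Ω`. -/
def atomsOn {M : ℕ} (Ω : Finset (Fin M)) : Set (Ω → ℂ) := subvec Ω '' atoms M

/-- The atomic norm `‖z‖_{𝒜(Ω)} = inf {t > 0 : z ∈ t conv 𝒜(Ω)}`. -/
def atomicNorm {M : ℕ} (Ω : Finset (Fin M)) (z : Ω → ℂ) : ℝ :=
  gauge (convexHull ℝ (atomsOn Ω)) z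

/-- The `ℓ₁` norm. -/
def l1norm {ι : Type*} [Fintype ι] (v : ι → ℂ) : ℝ := ‖WithLp.toLp 1 v‖

/-- The `ℓ₂` norm. -/
def l2norm {ι : Type*} [Fintype ι] (v : ι → ℂ) : ℝ := ‖WithLp.toLp 2 v‖

/-- The Toeplitz matrix `T(u)` with first row `u` and, below the diagonal, the conjugate entries. -/
def toeplitz {M : ℕ} (u : Fin M → ℂ) : Matrix (Fin M) (Fin M) ℂ :=
  Matrix.of fun j k =>
    if j ≤ k then u ⟨(k : ℕ) - j, by omega⟩ else star (u ⟨(j : ℕ) - k, by omega⟩)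

/-- The bordered matrix `[x yᴴ; y R]`. -/
def bordered {ι : Type*} (x : ℝ) (y : ι → ℂ) (R : Matrix ι ι ℂ) :
    Matrix (Unit ⊕ ι) (Unit ⊕ ι) ℂ :=
  Matrix.fromBlocks (Matrix.of fun _ _ => (x : ℂ)) (Matrix.of fun _ j => star (y j))
    (Matrix.of fun j _ => y j) R

/-- The value `yᴴ R⁻¹ y` for a positive semidefinite, possibly singular `R`: the least `x` with
`[x yᴴ; y R] ≥ 0`, and `+∞` if there is none (that is, if `y` is not in the range of `R`). -/
def invForm {ι : Type*} (R : Matrix ι ι ℂ) (y : ι → ℂ) : EReal :=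
  ⨅ x ∈ {x : ℝ | (bordered x y R).PosSemidef}, (x : EReal)

section Problems

variable {M : ℕ} {Ω : Finset (Fin M)}

/-- The covariance `R_Ω = Γ_Ω T(u) Γ_Ωᵀ + diag(σ_Ω)` of the observed samples. -/
def covariance (u : Fin M → ℂ) (σ : Ω → ℝ) : Matrix Ω Ω ℂ :=
  (toeplitz u).submatrix (fun j : Ω => (j : Fin M)) (fun j : Ω => (j : Fin M)) +
    Matrix.diagonal fun j => (σ j : ℂ)

/-- The objective `tr(R_Ω) + ‖y_Ω‖₂² y_Ωᴴ R_Ω⁻¹ y_Ω` of gridless SPICE. -/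
def glsObjective (y : Ω → ℂ) (p : (Fin M → ℂ) × (Ω → ℝ)) : EReal :=
  (((covariance p.1 p.2).trace.re : ℝ) : EReal) +
    ((l2norm y ^ 2 : ℝ) : EReal) * invForm (covariance p.1 p.2) y

/-- The feasible pairs `(u, σ_Ω)` of gridless SPICE, when `S` is the set of the noise variance
vectors that the noise model admits. -/
def glsFeasible (S : Set (Ω → ℝ)) : Set ((Fin M → ℂ) × (Ω → ℝ)) :=
  {p | (toeplitz p.1).PosSemidef ∧ p.2 ∈ S}

/-- The optimal solutions `u` of gridless SPICE. -/
def glsSolutions (S : Set (Ω → ℝ)) (y : Ω → ℂ) : Set (Fin M → ℂ) :=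
  {u | ∃ σ, (u, σ) ∈ glsFeasible S ∧ IsMinOn (glsObjective y) (glsFeasible S) (u, σ)}

/-- Heteroscedastic noise: the variances are unknown and may differ from each other. -/
def heteroscedastic (Ω : Finset (Fin M)) : Set (Ω → ℝ) := {σ | ∀ j, 0 ≤ σ j}

/-- Homoscedastic noise: the variances are unknown and equal. -/
def homoscedastic (Ω : Finset (Fin M)) : Set (Ω → ℝ) := {σ | ∃ s : ℝ, 0 ≤ s ∧ σ = fun _ => s}

/-- Homoscedastic noise with known variance `σ₀`. -/
def knownVariance (Ω : Finset (Fin M)) (σ₀ : ℝ) : Set (Ω → ℝ) := {fun _ => σ₀}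

/-- The objective `μ ‖z‖_{𝒜(Ω)} + g(y_Ω - z)` of atomic norm denoising, `z ∈ ℂ^Ω`. -/
def andObjective (μ : ℝ) (g : (Ω → ℂ) → ℝ) (y z : Ω → ℂ) : ℝ :=
  μ * atomicNorm Ω z + g (y - z)

/-- The objective `(μ/2) (x + u₁) + g(y_Ω - z_Ω)` of the semidefinite program of atomic norm
denoising in the variables `(x, u, z)`. The constraint makes `u₁` real. -/
def andSDPObjective [NeZero M] (μ : ℝ) (g : (Ω → ℂ) → ℝ) (y : Ω → ℂ)
    (q : ℝ × (Fin M → ℂ) × (Fin M → ℂ)) : ℝ :=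
  μ / 2 * (q.1 + (q.2.1 0).re) + g (y - subvec Ω q.2.2)

/-- The constraint `[x zᴴ; z T(u)] ≥ 0` on `(x, u, z)`. -/
def andSDPFeasible (M : ℕ) : Set (ℝ × (Fin M → ℂ) × (Fin M → ℂ)) :=
  {q | (bordered q.1 q.2.2 (toeplitz q.2.1)).PosSemidef}

/-- The optimal triples `(x, u, z)` of the semidefinite program of atomic norm denoising. -/
def andSDPOptimal [NeZero M] (μ : ℝ) (g : (Ω → ℂ) → ℝ) (y : Ω → ℂ) :
    Set (ℝ × (Fin M → ℂ) × (Fin M → ℂ)) :=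
  {q | q ∈ andSDPFeasible M ∧ IsMinOn (andSDPObjective μ g y) (andSDPFeasible M) q}

/-- The optimal solutions `u` of atomic norm denoising, formulated as a semidefinite program. -/
def andSolutions [NeZero M] (μ : ℝ) (g : (Ω → ℂ) → ℝ) (y : Ω → ℂ) : Set (Fin M → ℂ) :=
  {u | ∃ x z, (x, u, z) ∈ andSDPOptimal μ g y}

/-- The semidefinite program is an exact formulation of atomic norm denoising: it has the same
minimizers in `z_Ω` and the same optimal value. -/
def IsSDPFormulation [NeZero M] (μ : ℝ) (g : (Ω → ℂ) → ℝ) (y : Ω → ℂ) : Prop :=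
  (∀ z : Ω → ℂ, IsMinOn (andObjective μ g y) Set.univ z ↔
    ∃ q ∈ andSDPOptimal μ g y, subvec Ω q.2.2 = z) ∧
  ∀ q ∈ andSDPOptimal μ g y, andSDPObjective μ g y q = andObjective μ g y (subvec Ω q.2.2)

end Problems

/-- A Vandermonde decomposition `A = A(f) diag(p) A(f)ᴴ` with distinct frequencies `f_k ∈ [0, 1)`,
positive powers `p_k`, and `K = rank A` terms. -/
def IsVandermonde {M : ℕ} (A : Matrix (Fin M) (Fin M) ℂ) {K : ℕ} (f p : Fin K → ℝ) : Prop :=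
  K = A.rank ∧ (∀ k, f k ∈ Set.Ico (0 : ℝ) 1) ∧ Function.Injective f ∧ (∀ k, 0 < p k) ∧
    A = ∑ k, (p k : ℂ) • Matrix.vecMulVec (sinusoid M (f k)) (star (sinusoid M (f k)))

/-- The smallest eigenvalue of a Hermitian matrix. -/
def minEigenvalue {M : ℕ} (A : Matrix (Fin M) (Fin M) ℂ) : ℝ := sInf (spectrum ℝ A)

/-- The matrix `T(u) - λ_min(T(u)) I`, from which the estimates are retrieved if `T(u)` has full
rank. -/
def reducedToeplitz {M : ℕ} (u : Fin M → ℂ) : Matrix (Fin M) (Fin M) ℂ :=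
  toeplitz u - Matrix.diagonal fun _ => (minEigenvalue (toeplitz u) : ℂ)

/-- Two problems with the sets `U`, `V` of optimal solutions `u` have the same solution up to the
positive scale `c`: both are solvable, `U = c V`, and corresponding solutions give the same
frequency estimates, and the same power estimates up to the scale `c`. -/
def SameUpToScale {M : ℕ} (c : ℝ) (U V : Set (Fin M → ℂ)) : Prop :=
  0 < c ∧ U.Nonempty ∧ V.Nonempty ∧ U = (fun u => c • u) '' V ∧
    ∀ u ∈ V, ∀ (K : ℕ) (f p : Fin K → ℝ),
      (IsVandermonde (toeplitz (c • u)) f (c • p) ↔ IsVandermonde (toeplitz u) f p) ∧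
      (IsVandermonde (reducedToeplitz (c • u)) f (c • p) ↔ IsVandermonde (reducedToeplitz u) f p)

end GLS

end

open GLS

/-! ### Gram matrices and the spectral theorem for isometries -/

namespace GLS

open Matrix Module Module.End

/-! Write `Y` for the ℓ₂ norm of `y`, `L` for the size of `Ω`, and `c = Y / √L`.

SDP formulation. A feasible triple is the Gram matrix of vectors `w, v₀, …`. The Toeplitz structure
makes `v j ↦ v (j+1)` extend to an isometry, and diagonalizing it writes `z j = ⟨v j, w⟩` as a
combination of atoms of total weight at most `‖v 0‖ ‖w‖ ≤ (x + u₁) / 2`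
(`exists_atoms_of_toeplitz_gram`, `exists_mem_smul_convexHull`). Conversely each atom gives a
rank-one feasible triple, feasible triples form a convex cone, and compactness of sublevel sets
gives attainment (`exists_mem_andSDPFeasible_le_atomicNorm`).

Equivalence with GLS. For `R = T_Ω + diag σ`, the form `yᴴ R⁻¹ y` is the least `x₁ + ∑ σ_j |w_j|²`
over splittings `y = z_Ω + σ w` in which `x₁, z` border `T(u)`. For a fixed residual `r = σ w`, the
noise part `∑ σ_j + Y² ∑ σ_j |w_j|²` has minimum `κ g(r) + C` over the admitted `σ`, with `g` the
data fit of the noise model. The remaining part `L u₁ + Y² x₁` becomes `√L Y (x + u₁)` under `u ↦ c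
u`, `x ↦ x / c`. So, after partial minimization, the GLS objective is the AND objective under `t ↦ κ
t + C` (`glsSolutions_eq_image_andSolutions`). The claims on Vandermonde decompositions are
homogeneity under positive scaling. -/

/-- A positive semidefinite matrix is a Gram matrix. -/
lemma exists_gram_of_posSemidef {n : Type*} [Fintype n] {A : Matrix n n ℂ} (hA : A.PosSemidef) :
    ∃ (m : ℕ) (v : n → EuclideanSpace ℂ (Fin m)), ∀ j k, A j k = inner ℂ (v j) (v k) := by
  classical
  obtain ⟨m, b, rfl⟩ := posSemidef_iff_eq_sum_vecMulVec.1 hA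
  refine ⟨m, fun j => WithLp.toLp 2 fun i => star (b i j), fun j k => ?_⟩
  simp [Matrix.sum_apply, vecMulVec_apply, PiLp.inner_apply, mul_comm]

section Unitary

variable {H : Type*} [NormedAddCommGroup H] [InnerProductSpace ℂ H]

/-- Two families with the same Gram matrix are related by a linear isometry. -/
lemma exists_linearIsometry_of_inner_eq [FiniteDimensional ℂ H] {ι : Type*} [Fintype ι]
    (f g : ι → H) (h : ∀ i j, inner ℂ (f i) (f j) = inner ℂ (g i) (g j)) :
    ∃ U : H →ₗᵢ[ℂ] H, ∀ i, U (f i) = g i := by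
  classical
  let F := Fintype.linearCombination ℂ f
  let G := Fintype.linearCombination ℂ g
  have hinner : ∀ x y, inner ℂ (F x) (F y) = inner ℂ (G x) (G y) := fun x y => by
    simp [F, G, Fintype.linearCombination_apply, h]
  have hnorm : ∀ x, ‖F x‖ = ‖G x‖ := fun x => by
    rw [norm_eq_sqrt_re_inner (𝕜 := ℂ), hinner, ← norm_eq_sqrt_re_inner (𝕜 := ℂ)]
  -- The choice of the section `s` is harmless: `‖F x‖ = ‖G x‖` gives `F` and `G` the same kernel,
  -- so `G ∘ s` sends `F x` to `G x`.
  obtain ⟨s, hs⟩ := LinearMap.exists_rightInverse_of_surjective F.rangeRestrict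
    F.range_rangeRestrict
  have hs' : ∀ p : LinearMap.range F, F (s p) = p := fun p =>
    congrArg Subtype.val (LinearMap.congr_fun hs p)
  let L : LinearMap.range F →ₗᵢ[ℂ] H :=
    ⟨G ∘ₗ s, fun p => by
      rw [LinearMap.comp_apply, ← hnorm, hs']; rfl⟩
  refine ⟨L.extend, fun i => ?_⟩
  have hf : F (Pi.single i 1) = f i := by simp [F]
  have hg : G (Pi.single i 1) = g i := by simp [G]
  let p : LinearMap.range F := ⟨f i, Pi.single i 1, hf⟩
  have h1 : L.extend (f i) = L p := L.extend_apply p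
  have h2 : L p = G (s p) := rfl
  rw [h1, h2, ← hg, ← sub_eq_zero, ← map_sub, ← norm_eq_zero, ← hnorm, map_sub, hs', hf, sub_self,
    norm_zero]

lemma norm_eq_one_of_isometry_apply {U : H →ₗᵢ[ℂ] H} {x : H} {μ : ℂ} (hx : x ≠ 0)
    (h : U x = μ • x) : ‖μ‖ = 1 := by
  have := U.norm_map x
  rw [h, norm_smul] at this
  exact mul_right_cancel₀ (norm_ne_zero_iff.2 hx) (by rw [this, one_mul])

/-- Expand `⟨U x, U w⟩ = ⟨x, w⟩` and use `|μ| = 1`. This replaces the adjoint of `U` in the spectral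
argument. -/
lemma inner_isometry_eigenvector {U : H →ₗᵢ[ℂ] H} {x : H} {μ : ℂ}
    (h : U x = μ • x) (w : H) : inner ℂ x (U w) = μ * inner ℂ x w := by
  rcases eq_or_ne x 0 with rfl | hx
  · simp
  have hμ := norm_eq_one_of_isometry_apply hx h
  have h1 := U.inner_map_map x w
  rw [h, inner_smul_left] at h1
  rw [← h1, ← mul_assoc, Complex.mul_conj, Complex.normSq_eq_norm_sq, hμ]
  simp

lemma orthogonalFamily_eigenspaces_isometry (U : H →ₗᵢ[ℂ] H) :
    OrthogonalFamily ℂ (fun μ => eigenspace U.toLinearMap μ)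
      fun μ => (eigenspace U.toLinearMap μ).subtypeₗᵢ := by
  rintro μ ν hμν ⟨v, hv⟩ ⟨w, hw⟩
  rw [mem_eigenspace_iff] at hv hw
  have h := inner_isometry_eigenvector (U := U) hv w
  change U w = _ at hw
  rw [hw, inner_smul_right] at h
  by_contra h0
  exact hμν.symm (mul_right_cancel₀ h0 h)

/-- The complement is `U`-invariant; were it nonzero, `U` would have an eigenvector in it, which
would be orthogonal to itself. -/
lemma orthogonal_iSup_eigenspaces_isometry [FiniteDimensional ℂ H] (U : H →ₗᵢ[ℂ] H) :
    (⨆ μ, eigenspace U.toLinearMap μ)ᗮ = ⊥ := by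
  set p := (⨆ μ, eigenspace U.toLinearMap μ)ᗮ with hp
  have hinv : ∀ x ∈ p, U.toLinearMap x ∈ p := by
    intro x hx
    rw [hp, ← Submodule.iInf_orthogonal, Submodule.mem_iInf] at hx ⊢
    intro μ v hv
    have h := inner_isometry_eigenvector (U := U) (mem_eigenspace_iff.1 hv) x
    rw [hx μ v hv, mul_zero] at h
    exact h
  by_contra hne
  have : Nontrivial p := Submodule.nontrivial_iff_ne_bot.2 hne
  obtain ⟨c, hc⟩ := exists_eigenvalue (U.toLinearMap.restrict hinv)
  refine hc (eigenspace_restrict_eq_bot hinv ?_)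
  have H₂ : eigenspace U.toLinearMap c ⟂ p :=
    (Submodule.isOrtho_orthogonal_right _).mono_left (le_iSup _ c)
  exact H₂.disjoint

/-- The spectral theorem for linear isometries of a finite-dimensional complex space. -/
lemma exists_orthonormalBasis_isometry [FiniteDimensional ℂ H] (U : H →ₗᵢ[ℂ] H) :
    ∃ (n : ℕ) (b : OrthonormalBasis (Fin n) ℂ H) (μ : Fin n → ℂ),
      ∀ k, ‖μ k‖ = 1 ∧ U (b k) = μ k • b k := by
  classical
  have h1 : OrthogonalFamily ℂ (fun μ : Eigenvalues U.toLinearMap => eigenspace U.toLinearMap μ)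
      fun μ => (eigenspace U.toLinearMap μ).subtypeₗᵢ :=
    (orthogonalFamily_eigenspaces_isometry U).comp Subtype.coe_injective
  have h2 : DirectSum.IsInternal
      fun μ : Eigenvalues U.toLinearMap => eigenspace U.toLinearMap μ := by
    refine h1.isInternal_iff.2 ?_
    change (⨆ μ : {μ // eigenspace U.toLinearMap μ ≠ ⊥}, eigenspace U.toLinearMap μ)ᗮ = ⊥
    rw [iSup_ne_bot_subtype, orthogonal_iSup_eigenspaces_isometry]
  let b := h2.subordinateOrthonormalBasis rfl h1
  have hb : ∀ k, U (b k) = ((h2.subordinateOrthonormalBasisIndex rfl k h1 : Eigenvalues U.toLinearMap) : ℂ) • b k := fun k =>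
    mem_eigenspace_iff.1 (h2.subordinateOrthonormalBasis_subordinate rfl k h1)
  exact ⟨_, b, _, fun k => ⟨norm_eq_one_of_isometry_apply (b.orthonormal.ne_zero k) (hb k), hb k⟩⟩

/-- A finite sequence with Toeplitz Gram matrix is an orbit of a unitary operator, so its inner
products with a fixed vector `w` are a mixture of powers of unimodular numbers. -/
lemma exists_atoms_of_toeplitz_gram [FiniteDimensional ℂ H] {n : ℕ} (v : Fin (n + 1) → H) (w : H)
    (h : ∀ i j : Fin n,
      inner ℂ (v i.castSucc) (v j.castSucc) = inner ℂ (v i.succ) (v j.succ)) :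
    ∃ (d : ℕ) (μ c : Fin d → ℂ), (∀ k, ‖μ k‖ = 1) ∧
      (∀ j, inner ℂ (v j) w = ∑ k, c k * μ k ^ (j : ℕ)) ∧ ∑ k, ‖c k‖ ≤ ‖v 0‖ * ‖w‖ := by
  obtain ⟨U, hU⟩ := exists_linearIsometry_of_inner_eq _ _ h
  obtain ⟨d, b, μ, hμ⟩ := exists_orthonormalBasis_isometry U
  have hb : ∀ (j : Fin (n + 1)) (k : Fin d),
      inner ℂ (b k) (v j) = μ k ^ (j : ℕ) * inner ℂ (b k) (v 0) := by
    intro j k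
    induction j using Fin.induction with
    | zero => simp
    | succ i ih =>
      rw [← hU, inner_isometry_eigenvector (hμ k).2, ih, Fin.val_succ, pow_succ']
      simp [mul_assoc]
  -- The eigenvalues are conjugated because `v j = U^j (v 0)` stands in the conjugate-linear slot.
  refine ⟨d, fun k => star (μ k), fun k => inner ℂ (v 0) (b k) * inner ℂ (b k) w,
    fun k => by simp [(hμ k).1], fun j => ?_, ?_⟩
  · rw [← b.sum_inner_mul_inner]
    refine Finset.sum_congr rfl fun k _ => ?_
    rw [← inner_conj_symm (v j), hb, map_mul, inner_conj_symm, map_pow]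
    simp only [Complex.star_def]; ring
  · simp only [norm_mul]
    -- Cauchy–Schwarz, then Parseval for each factor.
    refine (Real.sum_mul_le_sqrt_mul_sqrt _ _ _).trans_eq ?_
    rw [b.sum_sq_norm_inner_left, b.sum_sq_norm_inner_right, Real.sqrt_sq (norm_nonneg _),
      Real.sqrt_sq (norm_nonneg _)]

end Unitary

/-! ### Schur complements without inverses -/

section Bordered

variable {ι : Type*} [Fintype ι]

/-- Congruence of `R` by `[w | 1]` accounts for everything but the corner, where the Schur
complement `x - wᴴ R w` is left; `R` may be singular. -/
lemma bordered_eq_factor [DecidableEq ι] (R : Matrix ι ι ℂ) (hR : R.IsHermitian) (w : ι → ℂ)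
    (x : ℝ) :
    bordered x (R *ᵥ w) R =
      (fromCols (replicateCol Unit w) 1)ᴴ * R * fromCols (replicateCol Unit w) 1 +
        diagonal (Sum.elim (fun _ => (x : ℂ) - star w ⬝ᵥ R *ᵥ w) fun _ => 0) := by
  have h : ∀ j, star ((R *ᵥ w) j) = (star w ᵥ* R) j := fun j => by
    rw [← Pi.star_apply, star_mulVec, hR.eq]
  ext (a | a) (c | c)
  · simp [bordered, Matrix.mul_apply, fromCols, dotProduct, mulVec, Finset.sum_mul, Finset.mul_sum,
      diagonal]
    rw [Finset.sum_comm]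
    simp [mul_assoc]
  · have := h c
    simp only [Complex.star_def] at this
    simp [bordered, Matrix.mul_apply, fromCols, diagonal, Matrix.one_apply, this, vecMul,
      dotProduct]
  · simp [bordered, Matrix.mul_apply, fromCols, dotProduct, mulVec, diagonal, Matrix.one_apply]
  · simp [bordered, Matrix.mul_apply, fromCols, diagonal, Matrix.one_apply]

/-- For `R ≥ 0`, the bordered matrix is positive semidefinite iff `y = R w` with `wᴴ R w ≤ x`. -/
lemma bordered_posSemidef_iff {R : Matrix ι ι ℂ} (hR : R.PosSemidef) {x : ℝ} {y : ι → ℂ} :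
    (bordered x y R).PosSemidef ↔ ∃ w, y = R *ᵥ w ∧ (star w ⬝ᵥ R *ᵥ w).re ≤ x := by
  classical
  constructor
  · intro h
    obtain ⟨m, v, hv⟩ := exists_gram_of_posSemidef h
    let S := Submodule.span ℂ (Set.range fun j : ι => v (Sum.inr j))
    let e := v (Sum.inl ())
    -- `w` holds the coefficients of the projection of the corner vector `e` onto the span of the
    -- others, so `wᴴ R w` is its squared norm, at most `‖e‖² = x`.
    obtain ⟨w, hw⟩ := (Submodule.mem_span_range_iff_exists_fun ℂ).1 (S.starProjection_apply_mem e)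
    have hR' : ∀ j k, R j k = inner ℂ (v (Sum.inr j)) (v (Sum.inr k)) := fun j k => by
      rw [← hv]; rfl
    have hy : ∀ j, y j = inner ℂ (v (Sum.inr j)) e := fun j => by rw [← hv]; rfl
    have hx : (x : ℂ) = inner ℂ e e := by rw [← hv]; rfl
    have hyw : y = R *ᵥ w := by
      ext j
      have : inner ℂ (v (Sum.inr j)) e = inner ℂ (v (Sum.inr j)) (S.starProjection e) := by
        rw [← sub_eq_zero, ← inner_sub_right]
        exact Submodule.sub_starProjection_mem_orthogonal e _ (Submodule.subset_span ⟨j, rfl⟩)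
      rw [hy, this, ← hw, inner_sum, mulVec, dotProduct]
      exact Finset.sum_congr rfl fun k _ => by rw [inner_smul_right, hR', mul_comm]
    refine ⟨w, hyw, ?_⟩
    have h1 : star w ⬝ᵥ R *ᵥ w = inner ℂ (S.starProjection e) (S.starProjection e) := by
      rw [← hw, sum_inner, dotProduct]
      refine Finset.sum_congr rfl fun j _ => ?_
      rw [inner_smul_left, inner_sum, Pi.star_apply, mulVec, dotProduct]
      congr 1
      exact Finset.sum_congr rfl fun k _ => by rw [inner_smul_right, hR', mul_comm]
    have h2 : x = ‖e‖ ^ 2 := by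
      rw [inner_self_eq_norm_sq_to_K] at hx
      have h3 : (x : ℂ) = ((‖e‖ ^ 2 : ℝ) : ℂ) := by rw [hx]; push_cast; rfl
      exact Complex.ofReal_injective h3
    rw [h1, inner_self_eq_norm_sq_to_K, h2]
    norm_cast
    exact pow_le_pow_left₀ (norm_nonneg _) (S.norm_starProjection_apply_le e) 2
  · rintro ⟨w, rfl, hw⟩
    rw [bordered_eq_factor R hR.isHermitian]
    refine (hR.conjTranspose_mul_mul_same _).add (PosSemidef.diagonal ?_)
    rintro (a | a)
    · have := hR.dotProduct_mulVec_nonneg w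
      rw [Complex.le_def] at this
      refine Complex.le_def.2 ⟨?_, ?_⟩
      · simpa using hw
      · simpa using this.2.symm
    · exact le_rfl

end Bordered
end GLS

/-! ### The closed convex cone of feasible triples -/

namespace GLS

open Matrix

lemma isClosed_posSemidef (n : Type*) [Fintype n] :
    IsClosed {A : Matrix n n ℂ | A.PosSemidef} := by
  simp only [posSemidef_iff_dotProduct_mulVec, Complex.le_def, Set.ofPred_and, Set.ofPred_forall]
  refine IsClosed.inter (isClosed_eq (by fun_prop) continuous_id) (isClosed_iInter fun x => ?_)
  exact (isClosed_le (by fun_prop) (by fun_prop)).inter (isClosed_eq (by fun_prop) (by fun_prop))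

section BorderedLinear

variable {ι : Type*}

lemma bordered_add (x x' : ℝ) (y y' : ι → ℂ) (R R' : Matrix ι ι ℂ) :
    bordered (x + x') (y + y') (R + R') = bordered x y R + bordered x' y' R' := by
  ext (a | a) (b | b) <;> simp [bordered]

lemma bordered_smul (c x : ℝ) (y : ι → ℂ) (R : Matrix ι ι ℂ) :
    bordered (c * x) (c • y) (c • R) = c • bordered x y R := by
  ext (a | a) (b | b) <;> simp [bordered]

lemma posSemidef_smul {n : Type*} {A : Matrix n n ℂ} (hA : A.PosSemidef) {c : ℝ} (hc : 0 ≤ c) :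
    (c • A).PosSemidef :=
  hA.smul hc

/-- Scaling the block `R` by `c` and the corner by `c⁻¹`. -/
lemma bordered_rescale [Fintype ι] {x c : ℝ} (hc : 0 < c) {y : ι → ℂ} {R : Matrix ι ι ℂ}
    (h : (bordered x y R).PosSemidef) : (bordered (c⁻¹ * x) y (c • R)).PosSemidef := by
  classical
  -- Congruence by `diag(c⁻¹, 1)` followed by the factor `c` leaves the border `y` fixed.
  let D : Matrix (Unit ⊕ ι) (Unit ⊕ ι) ℂ := diagonal (Sum.elim (fun _ => ((c⁻¹ : ℝ) : ℂ)) fun _ => 1)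
  have h1 := posSemidef_smul (h.conjTranspose_mul_mul_same D) hc.le
  have hc' : (c : ℂ) ≠ 0 := by exact_mod_cast hc.ne'
  convert h1 using 1
  ext (a | a) (b | b) <;>
    simp [bordered, D, Matrix.mul_apply, diagonal, hc', field]

lemma PosSemidef.of_bordered {x : ℝ} {y : ι → ℂ} {R : Matrix ι ι ℂ}
    (h : (bordered x y R).PosSemidef) : R.PosSemidef := by
  exact h.submatrix Sum.inr

end BorderedLinear

variable {M : ℕ}

lemma toeplitz_add (u v : Fin M → ℂ) : toeplitz (u + v) = toeplitz u + toeplitz v := by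
  ext j k
  simp only [toeplitz, of_apply, Matrix.add_apply, Pi.add_apply]
  split_ifs <;> simp

lemma toeplitz_smul (c : ℝ) (u : Fin M → ℂ) : toeplitz (c • u) = c • toeplitz u := by
  ext j k
  simp only [toeplitz, of_apply, Matrix.smul_apply, Pi.smul_apply]
  split_ifs <;> simp

lemma toeplitz_zero : toeplitz (0 : Fin M → ℂ) = 0 := by
  ext j k; simp [toeplitz]

lemma toeplitz_diag [NeZero M] (u : Fin M → ℂ) (j : Fin M) : toeplitz u j j = u 0 := by
  simp only [toeplitz, of_apply, le_refl, if_true, Nat.sub_self]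
  rfl

lemma toeplitz_zero_left [NeZero M] (u : Fin M → ℂ) (k : Fin M) : toeplitz u 0 k = u k := by
  simp [toeplitz]

/-- Shift invariance, the Gram hypothesis of `exists_atoms_of_toeplitz_gram`. -/
lemma toeplitz_succ {n : ℕ} (u : Fin (n + 1) → ℂ) (i j : Fin n) :
    toeplitz u i.castSucc j.castSucc = toeplitz u i.succ j.succ := by
  simp [toeplitz]

lemma continuous_toeplitz : Continuous (toeplitz (M := M)) := by
  refine continuous_matrix fun j k => ?_
  simp only [toeplitz, of_apply]
  split_ifs <;> fun_prop

lemma isClosed_andSDPFeasible (M : ℕ) : IsClosed (andSDPFeasible M) := by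
  refine (isClosed_posSemidef (Unit ⊕ Fin M)).preimage
    (f := fun q : ℝ × (Fin M → ℂ) × (Fin M → ℂ) => bordered q.1 q.2.2 (toeplitz q.2.1)) ?_
  unfold bordered
  refine Continuous.matrix_fromBlocks ?_ ?_ ?_ (continuous_toeplitz.comp (by fun_prop)) <;>
    exact continuous_matrix fun _ _ => by simp only [of_apply]; fun_prop

lemma zero_mem_andSDPFeasible (M : ℕ) : (0 : ℝ × (Fin M → ℂ) × (Fin M → ℂ)) ∈ andSDPFeasible M := by
  have : bordered 0 0 (toeplitz (0 : Fin M → ℂ)) = 0 := by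
    ext (a | a) (b | b) <;> simp [bordered, toeplitz_zero]
  change (bordered 0 0 (toeplitz (0 : Fin M → ℂ))).PosSemidef
  rw [this]; exact Matrix.PosSemidef.zero

lemma smul_mem_andSDPFeasible {q : ℝ × (Fin M → ℂ) × (Fin M → ℂ)} (hq : q ∈ andSDPFeasible M)
    {c : ℝ} (hc : 0 ≤ c) : c • q ∈ andSDPFeasible M := by
  change (bordered (c * q.1) (c • q.2.2) (toeplitz (c • q.2.1))).PosSemidef
  rw [toeplitz_smul, bordered_smul]
  exact posSemidef_smul hq hc

lemma add_mem_andSDPFeasible {q r : ℝ × (Fin M → ℂ) × (Fin M → ℂ)} (hq : q ∈ andSDPFeasible M)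
    (hr : r ∈ andSDPFeasible M) : q + r ∈ andSDPFeasible M := by
  change (bordered (q.1 + r.1) (q.2.2 + r.2.2) (toeplitz (q.2.1 + r.2.1))).PosSemidef
  rw [toeplitz_add, bordered_add]
  exact hq.add hr

/-- A feasible triple comes from vectors in a Hilbert space. -/
lemma exists_vectors_of_mem_andSDPFeasible [NeZero M] {q : ℝ × (Fin M → ℂ) × (Fin M → ℂ)}
    (hq : q ∈ andSDPFeasible M) :
    ∃ (m : ℕ) (w : EuclideanSpace ℂ (Fin m)) (v : Fin M → EuclideanSpace ℂ (Fin m)),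
      q.1 = ‖w‖ ^ 2 ∧ (∀ j, (q.2.1 0).re = ‖v j‖ ^ 2) ∧ (∀ j, q.2.2 j = inner ℂ (v j) w) ∧
      ∀ j k, toeplitz q.2.1 j k = inner ℂ (v j) (v k) := by
  obtain ⟨m, v, hv⟩ := exists_gram_of_posSemidef hq
  have hT : ∀ j k, toeplitz q.2.1 j k = inner ℂ (v (Sum.inr j)) (v (Sum.inr k)) := fun j k => by
    rw [← hv]; rfl
  refine ⟨m, v (Sum.inl ()), fun j => v (Sum.inr j), ?_, fun j => ?_, fun j => ?_, hT⟩
  · have h1 : (q.1 : ℂ) = inner ℂ (v (Sum.inl ())) (v (Sum.inl ())) := by rw [← hv]; rfl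
    rw [inner_self_eq_norm_sq_to_K] at h1
    have h3 : (q.1 : ℂ) = ((‖v (Sum.inl ())‖ ^ 2 : ℝ) : ℂ) := by rw [h1]; push_cast; rfl
    exact Complex.ofReal_injective h3
  · rw [← toeplitz_diag q.2.1 j, hT, inner_self_eq_norm_sq_to_K]
    norm_cast
  · rw [← hv]; rfl

/-- Weighted trace minimization over closed sets of feasible triples is solvable. -/
lemma exists_isMinOn_andSDP [NeZero M] {C : Set (ℝ × (Fin M → ℂ) × (Fin M → ℂ))} (hC : IsClosed C)
    (hne : (andSDPFeasible M ∩ C).Nonempty) {μ : ℝ} (hμ : 0 < μ) {h : (Fin M → ℂ) → ℝ}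
    (hcont : Continuous h) (hnonneg : ∀ z, 0 ≤ h z) :
    ∃ q ∈ andSDPFeasible M ∩ C,
      IsMinOn (fun q : ℝ × (Fin M → ℂ) × (Fin M → ℂ) => μ / 2 * (q.1 + (q.2.1 0).re) + h q.2.2)
        (andSDPFeasible M ∩ C) q := by
  set F := fun q : ℝ × (Fin M → ℂ) × (Fin M → ℂ) => μ / 2 * (q.1 + (q.2.1 0).re) + h q.2.2 with hF
  have hFc : Continuous F := by fun_prop
  obtain ⟨q₀, hq₀⟩ := hne
  -- This sublevel set is compact: the objective bounds `x + u₁`, which bounds all other entries by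
  -- Cauchy–Schwarz on the Gram vectors.
  set s := (andSDPFeasible M ∩ C) ∩ {q | F q ≤ F q₀} with hs
  have hsc : IsClosed s :=
    ((isClosed_andSDPFeasible M).inter hC).inter (isClosed_le hFc continuous_const)
  have hsb : Bornology.IsBounded s := by
    set B := 2 * F q₀ / μ with hB
    refine (Metric.isBounded_closedBall (x := (0 : ℝ × (Fin M → ℂ) × (Fin M → ℂ)))
      (r := B)).subset ?_
    rintro q ⟨⟨hq, -⟩, hle⟩
    obtain ⟨m, w, v, hw, hv, hz, hT⟩ := exists_vectors_of_mem_andSDPFeasible hq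
    have h1 : q.1 + (q.2.1 0).re ≤ B := by
      have := hnonneg q.2.2
      have hle' : μ / 2 * (q.1 + (q.2.1 0).re) + h q.2.2 ≤ F q₀ := hle
      rw [hB, le_div_iff₀ hμ]
      linarith
    have hx0 : 0 ≤ q.1 := hw ▸ sq_nonneg _
    have hu0 : 0 ≤ (q.2.1 0).re := hv 0 ▸ sq_nonneg _
    have hB0 : 0 ≤ B := by linarith
    rw [mem_closedBall_zero_iff, Prod.norm_def, Prod.norm_def, max_le_iff, max_le_iff,
      pi_norm_le_iff_of_nonneg hB0, pi_norm_le_iff_of_nonneg hB0]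
    refine ⟨by rw [Real.norm_of_nonneg hx0]; linarith, fun k => ?_, fun j => ?_⟩
    · rw [← toeplitz_zero_left q.2.1 k, hT]
      refine (norm_inner_le_norm _ _).trans ?_
      nlinarith [hv 0, hv k, sq_nonneg (‖v 0‖ - ‖v k‖)]
    · rw [hz]
      refine (norm_inner_le_norm _ _).trans ?_
      nlinarith [hv j, sq_nonneg (‖v j‖ - ‖w‖)]
  obtain ⟨q, hq, hmin⟩ := (Metric.isCompact_of_isClosed_isBounded hsc hsb).exists_isMinOn
    ⟨q₀, hq₀, le_refl (F q₀)⟩ hFc.continuousOn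
  refine ⟨q, hq.1, fun r hr => ?_⟩
  by_cases hrq : F r ≤ F q₀
  · exact hmin ⟨hr, hrq⟩
  · exact (show F q ≤ F q₀ from hq.2).trans (not_le.1 hrq).le

end GLS

/-! ### Atomic norm and semidefinite program -/

namespace GLS

open Matrix
open scoped Pointwise

lemma exists_frequency {μ : ℂ} (hμ : ‖μ‖ = 1) :
    ∃ f ∈ Set.Ico (0 : ℝ) 1, ∀ (M : ℕ) (j : Fin M), sinusoid M f j = μ ^ (j : ℕ) := by
  refine ⟨Int.fract (μ.arg / (2 * Real.pi)), ⟨Int.fract_nonneg _, Int.fract_lt_one _⟩,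
    fun M j => ?_⟩
  have hπ : (Real.pi : ℂ) ≠ 0 := by exact_mod_cast Real.pi_ne_zero
  have h1 : Complex.exp (2 * Real.pi * Complex.I * (Int.fract (μ.arg / (2 * Real.pi)) : ℝ)) = μ := by
    rw [Int.fract]
    conv_rhs => rw [← Complex.norm_mul_exp_arg_mul_I μ, hμ, Complex.ofReal_one, one_mul]
    rw [Complex.exp_eq_exp_iff_exists_int]
    refine ⟨-⌊μ.arg / (2 * Real.pi)⌋, ?_⟩
    push_cast
    field_simp
    ring
  conv_rhs => rw [← h1]
  rw [← Complex.exp_nat_mul, sinusoid]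
  congr 1
  ring

lemma sinusoid_mul_star {M : ℕ} (f : ℝ) (j k : Fin M) :
    sinusoid M f j * star (sinusoid M f k) =
      Complex.exp (2 * Real.pi * Complex.I * f * ((j : ℕ) - (k : ℕ) : ℂ)) := by
  simp only [sinusoid, Complex.star_def, ← Complex.exp_conj, map_mul, Complex.conj_I,
    Complex.conj_ofReal, map_natCast, map_ofNat, ← Complex.exp_add]
  congr 1
  ring

/-- The conjugate appears because the first row of `a aᴴ` is `conj a`. -/
lemma toeplitz_star_sinusoid {M : ℕ} (f : ℝ) :
    toeplitz (star (sinusoid M f)) = vecMulVec (sinusoid M f) (star (sinusoid M f)) := by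
  ext j k
  rw [vecMulVec_apply, Pi.star_apply, sinusoid_mul_star]
  simp only [toeplitz, of_apply, Pi.star_apply, star_star]
  split_ifs with h
  · have h' : (j : ℕ) ≤ k := h
    simp only [sinusoid, Complex.star_def, ← Complex.exp_conj, map_mul, Complex.conj_I,
      Complex.conj_ofReal, map_natCast, map_ofNat]
    congr 1
    push_cast [h']
    ring
  · have h' : (k : ℕ) ≤ j := (not_le.1 h).le
    simp only [sinusoid]
    congr 1
    push_cast [h']
    ring

variable {M : ℕ} [NeZero M] {Ω : Finset (Fin M)}

lemma continuous_subvec {M : ℕ} (Ω : Finset (Fin M)) : Continuous (subvec Ω) := by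
  unfold subvec; fun_prop

/-- Each feasible triple gives an atomic decomposition of total weight at most `(x + u₁) / 2`. -/
lemma exists_mem_smul_convexHull {q : ℝ × (Fin M → ℂ) × (Fin M → ℂ)}
    (hq : q ∈ andSDPFeasible M) :
    ∃ t, 0 ≤ t ∧ t ≤ (q.1 + (q.2.1 0).re) / 2 ∧ (t = 0 → subvec Ω q.2.2 = 0) ∧
      subvec Ω q.2.2 ∈ t • convexHull ℝ (atomsOn Ω) := by
  obtain ⟨n, rfl⟩ := Nat.exists_eq_succ_of_ne_zero (NeZero.ne M)
  obtain ⟨m, w, v, hw, hv, hz, hT⟩ := exists_vectors_of_mem_andSDPFeasible hq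
  obtain ⟨d, μ, c, hμ, hsum, hle⟩ := exists_atoms_of_toeplitz_gram v w
    fun i j => by rw [← hT, ← hT]; exact toeplitz_succ _ i j
  choose f hf hfμ using fun k => exists_frequency (hμ k)
  -- The phase of `c k`; the value `1` at `c k = 0` keeps it unimodular.
  let φ : Fin d → ℂ := fun k => if c k = 0 then 1 else c k / ‖c k‖
  have hφ : ∀ k, ‖φ k‖ = 1 := fun k => by
    by_cases h : c k = 0
    · simp [φ, h]
    · simp [φ, h]
  have hcφ : ∀ k, c k = ‖c k‖ * φ k := fun k => by
    by_cases h : c k = 0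
    · simp [φ, h]
    · have : (‖c k‖ : ℂ) ≠ 0 := by simpa using h
      simp only [φ, h, if_false]; field_simp
  let a : Fin d → Ω → ℂ := fun k => subvec Ω fun j => sinusoid (n + 1) (f k) j * φ k
  have ha : ∀ k, a k ∈ atomsOn Ω := fun k => ⟨_, ⟨f k, hf k, φ k, hφ k, rfl⟩, rfl⟩
  have hza : subvec Ω q.2.2 = ∑ k, ‖c k‖ • a k := by
    ext j
    have : subvec Ω q.2.2 j = q.2.2 j := rfl
    rw [this, hz, hsum, Finset.sum_apply]
    refine Finset.sum_congr rfl fun k _ => ?_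
    simp only [Pi.smul_apply, a, subvec, hfμ, Complex.real_smul]
    conv_lhs => rw [hcφ k]
    ring
  have ht0 : 0 ≤ ∑ k, ‖c k‖ := Finset.sum_nonneg fun _ _ => norm_nonneg _
  have hzero : ∑ k, ‖c k‖ = 0 → subvec Ω q.2.2 = 0 := fun h => by
    rw [hza]
    refine Finset.sum_eq_zero fun k hk => ?_
    rw [(Finset.sum_eq_zero_iff_of_nonneg fun _ _ => norm_nonneg _).1 h k hk, zero_smul]
  refine ⟨∑ k, ‖c k‖, ht0, ?_, hzero, ?_⟩
  · refine hle.trans ?_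
    rw [hw, hv 0]
    nlinarith [sq_nonneg (‖v 0‖ - ‖w‖)]
  · rcases ht0.eq_or_lt with h | h
    · have hne : (convexHull ℝ (atomsOn Ω)).Nonempty := by
        rw [convexHull_nonempty_iff]
        exact ⟨_, _, ⟨0, by simp, 1, by simp, rfl⟩, rfl⟩
      rw [← h, Set.zero_smul_set hne, hzero h.symm]
      rfl
    · refine Set.mem_smul_set.2 ⟨Finset.univ.centerMass (fun k => ‖c k‖) a, ?_, ?_⟩
      · exact Finset.centerMass_mem_convexHull _ (fun _ _ => norm_nonneg _) h fun k _ => ha k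
      · rw [Finset.centerMass, smul_smul, mul_inv_cancel₀ h.ne', one_smul, hza]

lemma atomicNorm_le_of_mem_andSDPFeasible {q : ℝ × (Fin M → ℂ) × (Fin M → ℂ)}
    (hq : q ∈ andSDPFeasible M) :
    atomicNorm Ω (subvec Ω q.2.2) ≤ (q.1 + (q.2.1 0).re) / 2 := by
  obtain ⟨t, ht0, ht, -, hmem⟩ := exists_mem_smul_convexHull (Ω := Ω) hq
  exact (gauge_le_of_mem ht0 hmem).trans ht

/-- The set of such `z` is convex, since feasible triples are closed under nonnegative combinations,
so atoms suffice; for them the bordered matrix is the rank-one matrix of `(conj φ, a(f))`. -/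
lemma exists_mem_andSDPFeasible_of_mem_convexHull {z : Ω → ℂ}
    (hz : z ∈ convexHull ℝ (atomsOn Ω)) :
    ∃ q ∈ andSDPFeasible M, subvec Ω q.2.2 = z ∧ q.1 + (q.2.1 0).re = 2 := by
  let K : Set (Ω → ℂ) := {z | ∃ q ∈ andSDPFeasible M, subvec Ω q.2.2 = z ∧ q.1 + (q.2.1 0).re = 2}
  suffices h : convexHull ℝ (atomsOn Ω) ⊆ K from h hz
  refine convexHull_min ?_ ?_
  · rintro _ ⟨_, ⟨f, -, φ, hφ, rfl⟩, rfl⟩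
    refine ⟨(1, star (sinusoid M f), fun j => sinusoid M f j * φ), ?_, rfl, ?_⟩
    · change (bordered 1 _ (toeplitz (star (sinusoid M f)))).PosSemidef
      rw [toeplitz_star_sinusoid]
      have h1 : φ * star φ = 1 := by
        rw [Complex.star_def, Complex.mul_conj, Complex.normSq_eq_norm_sq, hφ]; simp
      convert posSemidef_vecMulVec_self_star
        (Sum.elim (fun _ => star φ) (sinusoid M f) : Unit ⊕ Fin M → ℂ) using 1
      ext (a | a) (b | b) <;> simp [bordered, vecMulVec_apply, mul_comm]
      simpa [mul_comm] using h1.symm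
    · simp [sinusoid]; norm_num
  · rintro _ ⟨q, hq, rfl, hq2⟩ _ ⟨r, hr, rfl, hr2⟩ a b ha hb hab
    refine ⟨a • q + b • r,
      add_mem_andSDPFeasible (smul_mem_andSDPFeasible hq ha) (smul_mem_andSDPFeasible hr hb),
      rfl, ?_⟩
    simp only [Prod.fst_add, Prod.smul_fst, Prod.snd_add, Prod.smul_snd, Pi.add_apply,
      Pi.smul_apply, Complex.add_re, Complex.real_smul, Complex.re_ofReal_mul, smul_eq_mul]
    linear_combination a * hq2 + b * hr2 + 2 * hab

/-- Pad `z` by zeros and take `T(u) = I`. This starts the compactness argument and shows that the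
set defining the gauge of a nonzero `z` is nonempty. -/
lemma exists_mem_andSDPFeasible_subvec_eq (z : Ω → ℂ) :
    ∃ q ∈ andSDPFeasible M, subvec Ω q.2.2 = z := by
  classical
  let z' : Fin M → ℂ := fun j => if h : j ∈ Ω then z ⟨j, h⟩ else 0
  let e : Fin M → ℂ := Pi.single 0 1
  have he : toeplitz e = 1 := by
    ext j k
    simp only [toeplitz, of_apply, e, Pi.single_apply, Fin.ext_iff, Matrix.one_apply, Fin.val_zero,
      Fin.le_def]
    split_ifs <;> first | rfl | (simp; done) | (exfalso; omega)
  refine ⟨((star z' ⬝ᵥ (1 : Matrix (Fin M) (Fin M) ℂ) *ᵥ z').re, e, z'), ?_, ?_⟩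
  · change (bordered _ _ (toeplitz e)).PosSemidef
    rw [he, bordered_posSemidef_iff Matrix.PosSemidef.one]
    exact ⟨z', (one_mulVec _).symm, le_rfl⟩
  · ext j
    simp [subvec, z']

/-- The atomic norm is attained by a feasible triple. -/
lemma exists_mem_andSDPFeasible_le_atomicNorm (z : Ω → ℂ) :
    ∃ q ∈ andSDPFeasible M, subvec Ω q.2.2 = z ∧ (q.1 + (q.2.1 0).re) / 2 ≤ atomicNorm Ω z := by
  obtain ⟨q₀, hq₀, hqz₀⟩ := exists_mem_andSDPFeasible_subvec_eq z
  have hC : IsClosed {q : ℝ × (Fin M → ℂ) × (Fin M → ℂ) | subvec Ω q.2.2 = z} :=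
    isClosed_eq ((continuous_subvec Ω).comp (by fun_prop)) continuous_const
  obtain ⟨q, hq, hmin⟩ := exists_isMinOn_andSDP hC ⟨q₀, hq₀, hqz₀⟩ one_pos
    (h := fun _ => 0) continuous_const fun _ => le_rfl
  rcases eq_or_ne z 0 with rfl | hz
  · refine ⟨0, zero_mem_andSDPFeasible M, rfl, ?_⟩
    simp [atomicNorm, gauge_zero]
  refine ⟨q, hq.1, hq.2, ?_⟩
  obtain ⟨t, ht0, -, htz, hmem⟩ := exists_mem_smul_convexHull (Ω := Ω) hq₀
  rw [hqz₀] at htz hmem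
  have ht : 0 < t := ht0.lt_of_ne fun h => hz (htz h.symm)
  refine le_csInf ⟨t, ht, hmem⟩ ?_
  rintro r ⟨hr : 0 < r, k, hk, rfl⟩
  -- Every `r` competing in the gauge yields a feasible triple of value `r`, which the minimizer `q`
  -- does not exceed.
  obtain ⟨p, hp, hpz, hp2⟩ := exists_mem_andSDPFeasible_of_mem_convexHull hk
  have h1 : r • p ∈ andSDPFeasible M ∩ {q | subvec Ω q.2.2 = r • k} :=
    ⟨smul_mem_andSDPFeasible hp hr.le, by rw [← hpz]; rfl⟩
  have h2 := hmin h1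
  simp only [Set.mem_ofPred_eq, Prod.smul_fst, Prod.smul_snd, Pi.smul_apply, smul_eq_mul,
    Complex.real_smul, Complex.re_ofReal_mul, add_zero] at h2
  have h3 : r * p.1 + r * (p.2.1 0).re = r * 2 := by rw [← hp2]; ring
  linarith

/-- The semidefinite program is an exact formulation of atomic norm denoising. -/
lemma isSDPFormulation {μ : ℝ} (hμ : 0 ≤ μ) (g : (Ω → ℂ) → ℝ) (y : Ω → ℂ) :
    IsSDPFormulation μ g y := by
  have h1 : ∀ q ∈ andSDPFeasible M,
      andObjective μ g y (subvec Ω q.2.2) ≤ andSDPObjective μ g y q := fun q hq => by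
    have := mul_le_mul_of_nonneg_left (atomicNorm_le_of_mem_andSDPFeasible (Ω := Ω) hq) hμ
    unfold andObjective andSDPObjective
    linarith
  have h2 : ∀ z : Ω → ℂ, ∃ q ∈ andSDPFeasible M, subvec Ω q.2.2 = z ∧
      andSDPObjective μ g y q ≤ andObjective μ g y z := fun z => by
    obtain ⟨q, hq, rfl, hle⟩ := exists_mem_andSDPFeasible_le_atomicNorm z
    have := mul_le_mul_of_nonneg_left hle hμ
    refine ⟨q, hq, rfl, ?_⟩
    unfold andObjective andSDPObjective
    linarith
  refine ⟨fun z => ⟨fun hz => ?_, ?_⟩, ?_⟩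
  · obtain ⟨q, hq, hqz, hle⟩ := h2 z
    exact ⟨q, ⟨hq, fun r hr => hle.trans ((hz (Set.mem_univ _)).trans (h1 r hr))⟩, hqz⟩
  · rintro ⟨q, ⟨hq, hmin⟩, rfl⟩ z -
    obtain ⟨r, hr, -, hle⟩ := h2 z
    exact (h1 q hq).trans ((hmin hr).trans hle)
  · rintro q ⟨hq, hmin⟩
    obtain ⟨r, hr, -, hle⟩ := h2 (subvec Ω q.2.2)
    exact le_antisymm ((hmin hr).trans hle) (h1 q hq)

end GLS

/-! ### Scaling, and reduction of GLS to AND -/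

namespace GLS

open Matrix
open scoped Pointwise

section Scaling

variable {M : ℕ}

lemma minEigenvalue_smul {c : ℝ} (hc : 0 < c) (A : Matrix (Fin M) (Fin M) ℂ) :
    minEigenvalue (c • A) = c * minEigenvalue A := by
  have h : spectrum ℝ (c • A) = c • spectrum ℝ A :=
    spectrum.unit_smul_eq_smul A (Units.mk0 c hc.ne')
  rw [minEigenvalue, h, Real.sInf_smul_of_nonneg hc.le]
  rfl

lemma reducedToeplitz_smul {c : ℝ} (hc : 0 < c) (u : Fin M → ℂ) :
    reducedToeplitz (c • u) = c • reducedToeplitz u := by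
  rw [reducedToeplitz, reducedToeplitz, toeplitz_smul, minEigenvalue_smul hc, smul_sub]
  congr 1
  ext i j
  by_cases h : i = j <;> simp [h]

lemma rank_smul_of_pos {c : ℝ} (hc : 0 < c) (A : Matrix (Fin M) (Fin M) ℂ) :
    (c • A).rank = A.rank := by
  have h : c • A = A * diagonal fun _ => (c : ℂ) := by
    ext i j; simp [mul_comm]
  rw [h]
  refine rank_mul_eq_left_of_isUnit_det _ _ ?_
  rw [det_diagonal]
  simp [hc.ne']

lemma isVandermonde_smul_iff {c : ℝ} (hc : 0 < c) (A : Matrix (Fin M) (Fin M) ℂ) {K : ℕ}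
    (f p : Fin K → ℝ) : IsVandermonde (c • A) f (c • p) ↔ IsVandermonde A f p := by
  have h : ∑ k, ((c • p) k : ℂ) • vecMulVec (sinusoid M (f k)) (star (sinusoid M (f k))) =
      c • ∑ k, (p k : ℂ) • vecMulVec (sinusoid M (f k)) (star (sinusoid M (f k))) := by
    rw [Finset.smul_sum]
    refine Finset.sum_congr rfl fun k _ => ?_
    ext i j
    simp [mul_assoc]
  rw [IsVandermonde, IsVandermonde, rank_smul_of_pos hc, h, (smul_right_injective _ hc.ne').eq_iff]
  simp [hc]

lemma sameUpToScale {c : ℝ} (hc : 0 < c) {U V : Set (Fin M → ℂ)} (hV : V.Nonempty)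
    (h : U = (fun u => c • u) '' V) : SameUpToScale c U V :=
  ⟨hc, h ▸ hV.image _, hV, h, fun u _ K f p =>
    ⟨by rw [toeplitz_smul, isVandermonde_smul_iff hc],
      by rw [reducedToeplitz_smul hc, isVandermonde_smul_iff hc]⟩⟩

end Scaling

lemma invForm_le {ι : Type*} {R : Matrix ι ι ℂ} {x : ℝ} {y : ι → ℂ}
    (h : (bordered x y R).PosSemidef) : invForm R y ≤ x :=
  biInf_le (fun x : ℝ => (x : EReal)) h

/-- The infimum is attained at `wᴴ R w` for any `w` with `R w = y`; the value does not depend on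
`w`. -/
lemma exists_invForm_eq {ι : Type*} [Fintype ι] {R : Matrix ι ι ℂ} (hR : R.PosSemidef)
    {y : ι → ℂ} (h : invForm R y ≠ ⊤) :
    ∃ x : ℝ, (bordered x y R).PosSemidef ∧ invForm R y = x := by
  have hne : ∃ x : ℝ, (bordered x y R).PosSemidef := by
    by_contra! h'
    exact h (by simp [invForm, h'])
  obtain ⟨x, hx⟩ := hne
  obtain ⟨w, rfl, hw⟩ := (bordered_posSemidef_iff hR).1 hx
  have hb : (bordered (star w ⬝ᵥ R *ᵥ w).re (R *ᵥ w) R).PosSemidef :=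
    (bordered_posSemidef_iff hR).2 ⟨w, rfl, le_rfl⟩
  refine ⟨_, hb, le_antisymm (invForm_le hb) (le_iInf₂ fun x' hx' => ?_)⟩
  obtain ⟨w', hww, hle⟩ := (bordered_posSemidef_iff hR).1 hx'
  have : star w ⬝ᵥ R *ᵥ w = star w' ⬝ᵥ R *ᵥ w' := by
    rw [hww, dotProduct_mulVec, ← hR.isHermitian.eq, ← star_mulVec, hR.isHermitian.eq, hww,
      star_mulVec, ← dotProduct_mulVec, hR.isHermitian.eq]
  rw [this]
  exact_mod_cast hle

variable {M : ℕ} {Ω : Finset (Fin M)}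

lemma posSemidef_diagonal_ofReal {σ : Ω → ℝ} (hσ : ∀ j, 0 ≤ σ j) :
    (diagonal fun j => (σ j : ℂ)).PosSemidef :=
  PosSemidef.diagonal fun j => Complex.zero_le_real.2 (hσ j)

lemma covariance_posSemidef {u : Fin M → ℂ} {σ : Ω → ℝ} (hu : (toeplitz u).PosSemidef)
    (hσ : ∀ j, 0 ≤ σ j) : (covariance u σ).PosSemidef :=
  (hu.submatrix _).add (posSemidef_diagonal_ofReal hσ)

lemma trace_covariance [NeZero M] (u : Fin M → ℂ) (σ : Ω → ℝ) :
    (covariance u σ).trace.re = Ω.card * (u 0).re + ∑ j, σ j := by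
  simp [covariance, trace, toeplitz_diag, Finset.sum_add_distrib]

lemma dotProduct_diagonal_mulVec (σ : Ω → ℝ) (w : Ω → ℂ) :
    star w ⬝ᵥ (diagonal fun j => (σ j : ℂ)) *ᵥ w = ((∑ j, σ j * ‖w j‖ ^ 2 : ℝ) : ℂ) := by
  rw [dotProduct]
  push_cast
  refine Finset.sum_congr rfl fun j _ => ?_
  rw [mulVec_diagonal, Pi.star_apply, Complex.star_def, ← Complex.conj_mul']
  ring

/-- A splitting `y = z_Ω + diag(σ) w` bounds the value of the covariance form. -/
lemma bordered_covariance_of_split {x : ℝ} {u z : Fin M → ℂ} {σ : Ω → ℝ} {y w : Ω → ℂ}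
    (h : (bordered x z (toeplitz u)).PosSemidef) (hσ : ∀ j, 0 ≤ σ j)
    (hy : ∀ j, y j = z j + σ j * w j) :
    (bordered (x + ∑ j, σ j * ‖w j‖ ^ 2) y (covariance u σ)).PosSemidef := by
  have h1 : (bordered x (subvec Ω z)
      ((toeplitz u).submatrix (fun j : Ω => (j : Fin M)) fun j : Ω => (j : Fin M))).PosSemidef := by
    convert h.submatrix (Sum.map id fun j : Ω => (j : Fin M)) using 1
    ext (a | a) (b | b) <;> rfl
  have h2 : (bordered (∑ j, σ j * ‖w j‖ ^ 2) ((diagonal fun j => (σ j : ℂ)) *ᵥ w)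
      (diagonal fun j => (σ j : ℂ))).PosSemidef :=
    (bordered_posSemidef_iff (posSemidef_diagonal_ofReal hσ)).2
      ⟨w, rfl, by rw [dotProduct_diagonal_mulVec, Complex.ofReal_re]⟩
  have hy' : y = subvec Ω z + (diagonal fun j => (σ j : ℂ)) *ᵥ w := by
    ext j; rw [Pi.add_apply, mulVec_diagonal]; exact hy j
  rw [hy', covariance, bordered_add]
  exact h1.add h2

/-- Conversely every value of the covariance form dominates one that comes from a splitting. -/
lemma exists_split_of_bordered_covariance {x : ℝ} {u : Fin M → ℂ} {σ : Ω → ℝ} {y : Ω → ℂ}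
    (hu : (toeplitz u).PosSemidef) (hσ : ∀ j, 0 ≤ σ j)
    (h : (bordered x y (covariance u σ)).PosSemidef) :
    ∃ (x₁ : ℝ) (z : Fin M → ℂ) (w : Ω → ℂ), (bordered x₁ z (toeplitz u)).PosSemidef ∧
      (∀ j, y j = z j + σ j * w j) ∧ x₁ + ∑ j, σ j * ‖w j‖ ^ 2 ≤ x := by
  classical
  obtain ⟨w, rfl, hw⟩ := (bordered_posSemidef_iff (covariance_posSemidef hu hσ)).1 h
  -- With `w` padded by zeros, `z = T(u) w'` extends `T(u)_Ω w` to all indices at the same quadratic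
  -- value.
  let w' : Fin M → ℂ := fun j => if h : j ∈ Ω then w ⟨j, h⟩ else 0
  have hsum : ∀ F : Fin M → ℂ → ℂ, (∀ j, F j 0 = 0) → ∑ j, F j (w' j) = ∑ j : Ω, F j (w j) := by
    intro F hF
    rw [← Finset.sum_subset (Finset.subset_univ Ω), ← Finset.sum_coe_sort]
    · refine Finset.sum_congr rfl fun j _ => ?_
      simp [w']
    · intro j _ hj
      simp [w', hj, hF]
  have hT : ∀ j, (toeplitz u *ᵥ w') j = ∑ k : Ω, toeplitz u j k * w k := fun j =>
    hsum (fun k a => toeplitz u j k * a) (by simp)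
  have hq : star w' ⬝ᵥ toeplitz u *ᵥ w' = star w ⬝ᵥ
      (toeplitz u).submatrix (fun j : Ω => (j : Fin M)) (fun j : Ω => (j : Fin M)) *ᵥ w := by
    rw [dotProduct]
    simp only [Pi.star_apply, hT]
    rw [hsum (fun j a => star a * ∑ k : Ω, toeplitz u j k * w k) (by simp)]
    rfl
  refine ⟨_, _, w, (bordered_posSemidef_iff hu).2 ⟨w', rfl, le_rfl⟩, fun j => ?_, ?_⟩
  · rw [covariance, add_mulVec, Pi.add_apply, mulVec_diagonal, hT]
    rfl
  · rw [covariance, add_mulVec, dotProduct_add, dotProduct_diagonal_mulVec, Complex.add_re,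
      Complex.ofReal_re, ← hq] at hw
    exact hw

lemma l2norm_sq {ι : Type*} [Fintype ι] (v : ι → ℂ) : l2norm v ^ 2 = ∑ j, ‖v j‖ ^ 2 :=
  EuclideanSpace.norm_sq_eq _

lemma l1norm_eq_sum {ι : Type*} [Fintype ι] (v : ι → ℂ) : l1norm v = ∑ j, ‖v j‖ :=
  PiLp.norm_eq_of_L1 _

lemma l2norm_pos {ι : Type*} [Fintype ι] {v : ι → ℂ} (hv : v ≠ 0) : 0 < l2norm v := by
  rw [l2norm, norm_pos_iff]
  simpa using hv

lemma continuous_l1norm {ι : Type*} [Fintype ι] : Continuous (l1norm (ι := ι)) :=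
  (PiLp.continuous_toLp 1 _).norm

lemma continuous_l2norm {ι : Type*} [Fintype ι] : Continuous (l2norm (ι := ι)) :=
  (PiLp.continuous_toLp 2 _).norm

lemma andSolutions_nonempty [NeZero M] {μ : ℝ} (hμ : 0 < μ) {g : (Ω → ℂ) → ℝ} (hg : Continuous g)
    (hg0 : ∀ r, 0 ≤ g r) (y : Ω → ℂ) : (andSolutions μ g y).Nonempty := by
  obtain ⟨q, hq, hmin⟩ := exists_isMinOn_andSDP (C := Set.univ) isClosed_univ
    ⟨0, zero_mem_andSDPFeasible M, trivial⟩ hμ (h := fun z => g (y - subvec Ω z))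
    (hg.comp (continuous_const.sub (continuous_subvec Ω))) fun _ => hg0 _
  exact ⟨q.2.1, q.1, q.2.2, hq.1, fun r hr => hmin ⟨hr, trivial⟩⟩

/-- If minimizing the noise part of the gridless SPICE objective over the admitted variances gives
the data fit `κ g + C`, then gridless SPICE and atomic norm denoising have the same solutions up to
scale. -/
lemma glsSolutions_eq_image_andSolutions [NeZero M] (hΩ : Ω.Nonempty) {y : Ω → ℂ} (hy : y ≠ 0)
    {S : Set (Ω → ℝ)} (hS : ∀ σ ∈ S, ∀ j, 0 ≤ σ j) {μ κ C : ℝ} {g : (Ω → ℂ) → ℝ} (hκ : 0 < κ)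
    (hμ : κ * μ = 2 * √(Ω.card : ℝ) * l2norm y)
    (hlow : ∀ σ ∈ S, ∀ w : Ω → ℂ, κ * g (fun j => σ j * w j) + C ≤
      ∑ j, σ j + l2norm y ^ 2 * ∑ j, σ j * ‖w j‖ ^ 2)
    (hup : ∀ r : Ω → ℂ, ∃ σ ∈ S, ∃ w : Ω → ℂ, (r = fun j => σ j * w j) ∧
      ∑ j, σ j + l2norm y ^ 2 * ∑ j, σ j * ‖w j‖ ^ 2 ≤ κ * g r + C) :
    glsSolutions S y = (fun u => (l2norm y / √(Ω.card : ℝ)) • u) '' andSolutions μ g y := by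
  set Y := l2norm y with hYdef
  have hY : 0 < Y := l2norm_pos hy
  set ℓ := √(Ω.card : ℝ) with hℓdef
  have hℓ : 0 < ℓ := Real.sqrt_pos.2 (by exact_mod_cast hΩ.card_pos)
  have hL : (Ω.card : ℝ) = ℓ ^ 2 := (Real.sq_sqrt (Nat.cast_nonneg _)).symm
  set c := Y / ℓ with hcdef
  have hc : 0 < c := div_pos hY hℓ
  have hμ' : μ = 2 * ℓ * Y / κ := by rw [← hμ]; field_simp
  have hY2 : 0 < Y ^ 2 := by positivity
  have upper : ∀ q ∈ andSDPFeasible M, ∃ σ, (c • q.2.1, σ) ∈ glsFeasible S ∧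
      glsObjective y (c • q.2.1, σ) ≤ ((κ * andSDPObjective μ g y q + C : ℝ) : EReal) := by
    intro q hq
    obtain ⟨σ, hσ, w, hr, hle⟩ := hup (y - subvec Ω q.2.2)
    have hq' : (bordered (c⁻¹ * q.1) q.2.2 (toeplitz (c • q.2.1))).PosSemidef := by
      rw [toeplitz_smul]; exact bordered_rescale hc hq
    refine ⟨σ, ⟨PosSemidef.of_bordered hq', hσ⟩, ?_⟩
    have hb := bordered_covariance_of_split (y := y) hq' (hS σ hσ) (w := w) fun j => by
      have := congrFun hr j
      simp only [Pi.sub_apply, subvec] at this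
      rw [← this]; ring
    refine (add_le_add_right (mul_le_mul_of_nonneg_left (invForm_le hb)
      (by exact_mod_cast hY2.le)) _).trans ?_
    norm_cast
    rw [trace_covariance, andSDPObjective, hL, hμ']
    have h1 : ((c • q.2.1) 0).re = c * (q.2.1 0).re := by simp
    rw [h1]
    have h2 : ℓ ^ 2 * (c * (q.2.1 0).re) + Y ^ 2 * (c⁻¹ * q.1) =
        κ * (2 * ℓ * Y / κ / 2 * (q.1 + (q.2.1 0).re)) := by
      rw [hcdef]; field_simp; ring
    linarith
  -- A real bound `m` in place of the extended real objective ensures that the form is finite.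
  have lower : ∀ (u : Fin M → ℂ) (σ : Ω → ℝ), (u, σ) ∈ glsFeasible S → ∀ m : ℝ,
      glsObjective y (u, σ) ≤ m → ∃ q ∈ andSDPFeasible M, u = c • q.2.1 ∧
        κ * andSDPObjective μ g y q + C ≤ m := by
    rintro u σ ⟨hu, hσ⟩ m hm
    have htop : invForm (covariance u σ) y ≠ ⊤ := by
      intro h
      rw [glsObjective, h, EReal.coe_mul_top_of_pos hY2, EReal.coe_add_top, top_le_iff] at hm
      exact EReal.coe_ne_top m hm
    obtain ⟨x, hx, hinv⟩ := exists_invForm_eq (covariance_posSemidef hu (hS σ hσ)) htop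
    obtain ⟨x₁, z, w, hb, hyz, hle⟩ := exists_split_of_bordered_covariance hu (hS σ hσ) hx
    rw [glsObjective, hinv] at hm
    norm_cast at hm
    rw [trace_covariance, hL] at hm
    have hc' : 0 < c⁻¹ := inv_pos.2 hc
    refine ⟨(c * x₁, c⁻¹ • u, z), ?_, by rw [smul_smul, mul_inv_cancel₀ hc.ne', one_smul], ?_⟩
    · have := bordered_rescale hc' hb
      rwa [inv_inv, ← toeplitz_smul] at this
    · have h1 : y - subvec Ω z = fun j => σ j * w j := by
        ext j
        simp only [Pi.sub_apply, subvec, hyz j]; ring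
      have h2 := hlow σ hσ w
      rw [andSDPObjective, h1, hμ']
      have h3 : ((c⁻¹ • u) 0).re = c⁻¹ * (u 0).re := by simp
      have h4 : ℓ ^ 2 * (u 0).re + Y ^ 2 * x₁ =
          κ * (2 * ℓ * Y / κ / 2 * (c * x₁ + c⁻¹ * (u 0).re)) := by
        rw [hcdef]; field_simp; ring
      have h5 := mul_le_mul_of_nonneg_left hle hY2.le
      simp only [h3]
      simp only at hm
      linarith
  have cancel : ∀ a b : ℝ, κ * a + C ≤ κ * b + C → a ≤ b := fun a b h =>
    le_of_mul_le_mul_left (by linarith) hκ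
  ext u
  constructor
  · rintro ⟨σ, hf, hmin⟩
    -- The zero triple provides a finite competitor, so a GLS minimizer has a real value.
    obtain ⟨σ₀, hf₀, hle₀⟩ := upper 0 (zero_mem_andSDPFeasible M)
    have hval : ∃ m : ℝ, glsObjective y (u, σ) ≤ m ∧ ∀ m' : ℝ, glsObjective y (u, σ) ≤ m' → m ≤ m' := by
      obtain ⟨hu, hσ⟩ := hf
      have htop : invForm (covariance u σ) y ≠ ⊤ := by
        intro h
        have := (hmin hf₀).trans hle₀
        rw [glsObjective, h, EReal.coe_mul_top_of_pos hY2, EReal.coe_add_top, top_le_iff] at this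
        exact EReal.coe_ne_top _ this
      obtain ⟨x, hx, hinv⟩ := exists_invForm_eq (covariance_posSemidef hu (hS σ hσ)) htop
      refine ⟨(covariance u σ).trace.re + Y ^ 2 * x, ?_, fun m' hm' => ?_⟩
      · rw [glsObjective, hinv]; norm_cast
      · rw [glsObjective, hinv] at hm'
        exact_mod_cast hm'
    obtain ⟨m, hm, hm'⟩ := hval
    obtain ⟨q, hq, rfl, hqm⟩ := lower u σ hf m hm
    refine ⟨q.2.1, ⟨q.1, q.2.2, hq, fun r hr => cancel _ _ (hqm.trans ?_)⟩, rfl⟩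
    obtain ⟨σ', hf', hle'⟩ := upper r hr
    exact hm' _ ((hmin hf').trans hle')
  · rintro ⟨u, ⟨x, z, hq, hmin⟩, rfl⟩
    obtain ⟨σ, hf, hle⟩ := upper _ hq
    refine ⟨σ, hf, fun p hp => ?_⟩
    by_contra hlt
    have hlt' : glsObjective y p < glsObjective y (c • u, σ) := not_le.1 hlt
    -- `lower` at a real number strictly between the two values produces a triple that beats the AND
    -- minimizer.
    obtain ⟨m, hm1, hm2⟩ := EReal.lt_iff_exists_real_btwn.1 hlt'
    obtain ⟨r, hr, -, hrm⟩ := lower p.1 p.2 hp m hm1.le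
    have h1 : andSDPObjective μ g y (x, u, z) ≤ andSDPObjective μ g y r := hmin hr
    have h2 : (m : EReal) < ((κ * andSDPObjective μ g y (x, u, z) + C : ℝ) : EReal) :=
      hm2.trans_le hle
    have h3 : m < κ * andSDPObjective μ g y (x, u, z) + C := by exact_mod_cast h2
    have h4 := mul_le_mul_of_nonneg_left h1 hκ.le
    linarith

end GLS

/-! ### The three noise models -/

namespace GLS

variable {M : ℕ} [NeZero M] {Ω : Finset (Fin M)} {y : Ω → ℂ}

lemma glsSolutions_heteroscedastic (hΩ : Ω.Nonempty) (hy : y ≠ 0) :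
    glsSolutions (heteroscedastic Ω) y =
      (fun u => (l2norm y / √(Ω.card : ℝ)) • u) '' andSolutions √(Ω.card : ℝ) l1norm y := by
  have hY := l2norm_pos hy
  refine glsSolutions_eq_image_andSolutions hΩ hy (κ := 2 * l2norm y) (C := 0) (fun σ hσ => hσ)
    (by positivity) (by ring) (fun σ hσ w => ?_) fun r => ?_
  · rw [l1norm_eq_sum, add_zero, Finset.mul_sum, Finset.mul_sum, ← Finset.sum_add_distrib]
    refine Finset.sum_le_sum fun j _ => ?_
    have hj : 0 ≤ σ j := hσ j
    rw [norm_mul, Complex.norm_real, Real.norm_of_nonneg hj]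
    -- AM–GM in each coordinate: `2 Y |w_j| ≤ 1 + Y² |w_j|²`, multiplied by `σ_j`.
    nlinarith [mul_nonneg hj (sq_nonneg (1 - l2norm y * ‖w j‖))]
  -- The equality case `Y |w_j| = 1`; where `r j = 0`, both `σ_j` and the quotient `w_j` are `0`.
  · refine ⟨fun j => l2norm y * ‖r j‖, fun j => by positivity,
      fun j => r j / (l2norm y * ‖r j‖ : ℝ), ?_, ?_⟩
    · ext j
      rcases eq_or_ne (r j) 0 with h | h
      · simp [h]
      · have : ((l2norm y * ‖r j‖ : ℝ) : ℂ) ≠ 0 := by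
          have := norm_pos_iff.2 h
          exact_mod_cast (by positivity : l2norm y * ‖r j‖ ≠ 0)
        rw [mul_div_cancel₀ _ this]
    · rw [l1norm_eq_sum, add_zero, Finset.mul_sum, Finset.mul_sum, ← Finset.sum_add_distrib]
      refine Finset.sum_le_sum fun j _ => ?_
      rcases eq_or_ne (r j) 0 with h | h
      · simp [h]
      · have := norm_pos_iff.2 h
        rw [norm_div, Complex.norm_real, Real.norm_of_nonneg (by positivity)]
        field_simp
        norm_num

lemma l2norm_smul {ι : Type*} [Fintype ι] (c : ℂ) (v : ι → ℂ) :
    l2norm (fun j => c * v j) = ‖c‖ * l2norm v :=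
  norm_smul c (WithLp.toLp 2 v)

lemma glsSolutions_homoscedastic (hΩ : Ω.Nonempty) (hy : y ≠ 0) :
    glsSolutions (homoscedastic Ω) y =
      (fun u => (l2norm y / √(Ω.card : ℝ)) • u) '' andSolutions 1 l2norm y := by
  have hY := l2norm_pos hy
  have hℓ : 0 < √(Ω.card : ℝ) := Real.sqrt_pos.2 (by exact_mod_cast hΩ.card_pos)
  have hsum : ∀ (s : ℝ) (w : Ω → ℂ), ∑ _j : Ω, s + l2norm y ^ 2 * ∑ j, s * ‖w j‖ ^ 2 =
      √(Ω.card : ℝ) ^ 2 * s + l2norm y ^ 2 * (s * l2norm w ^ 2) := fun s w => by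
    rw [Real.sq_sqrt (Nat.cast_nonneg _), l2norm_sq w, ← Finset.mul_sum]; simp
  refine glsSolutions_eq_image_andSolutions hΩ hy (κ := 2 * √(Ω.card : ℝ) * l2norm y) (C := 0)
    ?_ (by positivity) (by ring) ?_ fun r => ?_
  · rintro _ ⟨s, hs, rfl⟩ -
    exact hs
  · rintro _ ⟨s, hs, rfl⟩ w
    rw [hsum, l2norm_smul, Complex.norm_real, Real.norm_of_nonneg hs]
    nlinarith [mul_nonneg hs (sq_nonneg (√(Ω.card : ℝ) - l2norm y * l2norm w))]
  · have hr : 0 ≤ l2norm r := norm_nonneg _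
    -- Equality in the bound above requires `Y ‖w‖ = √L` when `s > 0`, and `r = s w` then fixes `s`.
    let s := l2norm y * l2norm r / √(Ω.card : ℝ)
    have hs : 0 ≤ s := by positivity
    refine ⟨fun _ => s, ⟨s, hs, rfl⟩, fun j => (s : ℂ)⁻¹ * r j, ?_, ?_⟩
    · ext j
      rcases eq_or_ne r 0 with rfl | h
      · simp
      · have := l2norm_pos h
        have : (s : ℂ) ≠ 0 := by exact_mod_cast (by positivity : s ≠ 0)
        rw [mul_inv_cancel_left₀ this]
    · rw [hsum, l2norm_smul, norm_inv, Complex.norm_real, Real.norm_of_nonneg hs]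
      rcases hr.eq_or_lt with h | h
      · simp [s, ← h]
      · simp only [s]
        field_simp
        norm_num

/-- With `σ` fixed, the residual determines `w = r / σ₀`, so both bounds are one identity; the trace
of the noise is the constant `C = L σ₀`. -/
lemma glsSolutions_knownVariance (hΩ : Ω.Nonempty) (hy : y ≠ 0) {σ₀ : ℝ} (hσ₀ : 0 < σ₀) :
    glsSolutions (knownVariance Ω σ₀) y = (fun u => (l2norm y / √(Ω.card : ℝ)) • u) ''
      andSolutions (√(Ω.card : ℝ) / l2norm y * σ₀) (fun v => 1 / 2 * l2norm v ^ 2) y := by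
  have hY := l2norm_pos hy
  have hsum : ∀ w : Ω → ℂ, ∑ _j : Ω, σ₀ + l2norm y ^ 2 * ∑ j, σ₀ * ‖w j‖ ^ 2 =
      2 * l2norm y ^ 2 / σ₀ * (1 / 2 * l2norm (fun j => (σ₀ : ℂ) * w j) ^ 2) + Ω.card * σ₀ :=
    fun w => by
      rw [l2norm_smul, Complex.norm_real, Real.norm_of_nonneg hσ₀.le, ← Finset.mul_sum,
        ← l2norm_sq w]
      simp
      field_simp
      ring
  refine glsSolutions_eq_image_andSolutions hΩ hy (κ := 2 * l2norm y ^ 2 / σ₀) (C := Ω.card * σ₀)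
    ?_ (by positivity) (by field_simp) ?_ fun r => ?_
  · rintro _ rfl -
    exact hσ₀.le
  · rintro _ rfl w
    exact (hsum w).ge
  · have h : r = fun j => (σ₀ : ℂ) * ((σ₀ : ℂ)⁻¹ * r j) := by
      ext j
      rw [mul_inv_cancel_left₀ (by exact_mod_cast hσ₀.ne')]
    refine ⟨_, rfl, fun j => (σ₀ : ℂ)⁻¹ * r j, h, ?_⟩
    rw [hsum, ← h]

end GLS

theorem theorem2 {M : ℕ} [NeZero M] (Ω : Finset (Fin M)) (hΩ : Ω.Nonempty)
    (y : Ω → ℂ) (hy : y ≠ 0) :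
    -- heteroscedastic noise
    (IsSDPFormulation √(Ω.card : ℝ) l1norm y ∧
      SameUpToScale (l2norm y / √(Ω.card : ℝ)) (glsSolutions (heteroscedastic Ω) y)
        (andSolutions √(Ω.card : ℝ) l1norm y)) ∧
    -- homoscedastic noise
    (IsSDPFormulation 1 l2norm y ∧
      SameUpToScale (l2norm y / √(Ω.card : ℝ)) (glsSolutions (homoscedastic Ω) y)
        (andSolutions 1 l2norm y)) ∧
    -- homoscedastic noise with known variance
    (∀ σ₀ : ℝ, 0 < σ₀ →
      IsSDPFormulation (√(Ω.card : ℝ) / l2norm y * σ₀) (fun v => 1 / 2 * l2norm v ^ 2) y ∧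
      SameUpToScale (l2norm y / √(Ω.card : ℝ)) (glsSolutions (knownVariance Ω σ₀) y)
        (andSolutions (√(Ω.card : ℝ) / l2norm y * σ₀) (fun v => 1 / 2 * l2norm v ^ 2) y)) := by
  have hY := l2norm_pos hy
  have hℓ : 0 < √(Ω.card : ℝ) := Real.sqrt_pos.2 (by exact_mod_cast hΩ.card_pos)
  have hc : 0 < l2norm y / √(Ω.card : ℝ) := div_pos hY hℓ
  refine ⟨⟨isSDPFormulation hℓ.le _ y, sameUpToScale hc ?_ (glsSolutions_heteroscedastic hΩ hy)⟩,
    ⟨isSDPFormulation zero_le_one _ y, sameUpToScale hc ?_ (glsSolutions_homoscedastic hΩ hy)⟩,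
    fun σ₀ hσ₀ => ⟨isSDPFormulation (by positivity) _ y,
      sameUpToScale hc ?_ (glsSolutions_knownVariance hΩ hy hσ₀)⟩⟩
  · exact andSolutions_nonempty hℓ continuous_l1norm (fun _ => norm_nonneg _) y
  · exact andSolutions_nonempty one_pos continuous_l2norm (fun _ => norm_nonneg _) y
  · exact andSolutions_nonempty (by positivity) ((continuous_l2norm.pow 2).const_mul _)
      (fun v => mul_nonneg (by norm_num) (sq_nonneg (l2norm v))) y
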